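/- Let $K$ be a field of characteristic $0$ and let $L$ be a finite-dimensional associative (not necessarily unital or commutative) $K$-algebra with basis $(H_\nu)$ and multiplication $H_\mu H_\nu=\sum_\sigma B_{\mu\nu}^\sigma H_\sigma$; let $(X^\nu)$ be the dual basis of $L^*$. Let $R$ be the unital associative algebra with basis $\hat E,\hat H_\nu,\hat X^\nu$, identity $\hat E$, and products $$\hat H_\mu\hat H_\nu=\sum_\sigma B_{\mu\nu}^\sigma\hat H_\sigma,\quad \hat X^\nu\hat H_\mu=\sum_\sigma B_{\mu\sigma}^\nu\hat X^\sigma,\quad \hat X^\mu\hat X^\nu=0,\quad \hat H_\mu\hat X^\nu=0,$$ and let $\mathfrak g=L\oplus L^*$ be the Lie algebra with brackets $[H_\mu,H_\nu]=\sum_\sigma(B_{\mu\nu}^\sigma-B_{\nu\mu}^\sigma)H_\sigma$, $[H_\mu,X^\nu]=-\sum_\sigma B_{\mu\sigma}^\nu X^\sigma$, $[X^\mu,X^\nu]=0$. In $U(\mathfrak g)$, let $U(L)$ be the subalgebra generated by the $H_\nu$ and $U_d(L^*)$ the span of the products of $d$ of the $X^\nu$. Let $T(R)=\prod_{n\ge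 0}R^{\otimes n}$, with componentwise product, with the deconcatenation coproduct $\Delta$ (given by the identifications $R^{\otimes(m+n)}\cong R^{\otimes m}\otimes R^{\otimes n}$), and with the projection to $R^{\otimes 0}=K$ as counit. The map $x\mapsto\bigl(\sum_{i=1}^n 1\otimes\cdots\otimes\hat x\otimes\cdots\otimes 1\bigr)_n$ (with $\hat x$ in place $i$), $x\in\mathfrak g$, extends to an algebra homomorphism $U(\mathfrak g)\to T(R)$. A twisting cocycle in the completed tensor square $\prod_{m,n}R^{\otimes m}\otimes R^{\otimes n}$ of $T(R)$ is an invertible element $\Phi=(\Phi^{m,n})$ with $\Phi^{0,n}=1$, $\Phi^{m,0}=1$ and $$(\Delta\otimes\mathrm{id})(\Phi)\,\Phi_{12}=(\mathrm{id}\otimes\Delta)(\Phi)\,\Phi_{23}.$$ Let $\Phi^{1,1}=\hat E\otimes\hat E-\sum_\nu\hat X^\nu\otimes\hat H_\nu$. Then there is exactly one twisting cocycle $\Phi$ such that $\Phi^{1,k}=\Phi^{1,1}_{12}\Phi^{1,1}_{13}\cdots\Phi^{1,1}_{1,k+1}$ for all $k\ge 0$ (the twisting cocycle obtained from $\Phi^{1,1}$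 by the modified Reshetikhin procedure). It lies in the completion $\prod_d U_d(L^*)\otimes U(L)$ of $U(L^*)\otimes U(L)$ and has the form $\exp\bigl(-\sum_\nu\tilde X^\nu\otimes H_\nu\bigr)$, where each $\tilde X^\nu\in\prod_{d\ge 1}U_d(L^*)$ is a formal power series without constant term in the commuting elements $X^\mu$. That is, there are such $\tilde X^\nu$ for which all homogeneous components of this exponential lie in $U_d(L^*)\otimes U(L)$, and, for all $m,n$, the images of these components in $R^{\otimes m}\otimes R^{\otimes n}$ are zero for almost all $d$ and have sum $\Phi^{m,n}$. -/

import Mathlib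

open scoped TensorProduct

noncomputable section

/-! ### The ring `R` -/

section Ring

variable (K L : Type*) [Field K] [NonUnitalRing L] [Module K L]

/-- The underlying space `L ⊕ L*` of the semidirect product of a ring `L` with its dual. -/
def SemidirectRing : Type _ := L × Module.Dual K L

namespace SemidirectRing

instance : AddCommGroup (SemidirectRing K L) := inferInstanceAs (AddCommGroup (L × Module.Dual K L))

instance : Module K (SemidirectRing K L) := inferInstanceAs (Module K (L × Module.Dual K L))

/-- The inclusion of `L`. -/
def ofH : L →ₗ[K] SemidirectRing K L := LinearMap.inl K L (Module.Dual K L)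

/-- The inclusion of `L*`. -/
def ofX : Module.Dual K L →ₗ[K] SemidirectRing K L := LinearMap.inr K L (Module.Dual K L)

variable {K L} in
lemma ext' {a b : SemidirectRing K L} (h₁ : a.1 = b.1) (h₂ : ∀ l, a.2 l = b.2 l) : a = b :=
  Prod.ext h₁ (LinearMap.ext h₂)

variable {K L} in
@[simp] lemma add_fst (a b : SemidirectRing K L) : (a + b).1 = a.1 + b.1 := rfl

variable {K L} in
@[simp] lemma add_snd (a b : SemidirectRing K L) : (a + b).2 = a.2 + b.2 := rfl

variable {K L} in
@[simp] lemma smul_fst (c : K) (a : SemidirectRing K L) : (c • a).1 = c • a.1 := rfl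

variable {K L} in
@[simp] lemma smul_snd (c : K) (a : SemidirectRing K L) : (c • a).2 = c • a.2 := rfl

variable {K L} in
@[simp] lemma zero_fst : (0 : SemidirectRing K L).1 = 0 := rfl

variable {K L} in
@[simp] lemma zero_snd : (0 : SemidirectRing K L).2 = 0 := rfl

variable [SMulCommClass K L L]

/-- The product `(h, ξ) (h', ξ') = (h h', ξ · h')`, where `(ξ · h') (l) = ξ (h' l)` is the right
action of `L` on `L*`; in particular `H X = 0` and `X X' = 0`. -/
instance : Mul (SemidirectRing K L) :=
  ⟨fun a b => (a.1 * b.1, a.2.comp (LinearMap.mulLeft K b.1))⟩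

variable {K L} in
@[simp] lemma mul_fst (a b : SemidirectRing K L) : (a * b).1 = a.1 * b.1 := rfl

variable {K L} in
@[simp] lemma mul_snd_apply (a b : SemidirectRing K L) (l : L) :
    (a * b).2 l = a.2 (b.1 * l) := rfl

variable [IsScalarTower K L L]

instance : NonUnitalRing (SemidirectRing K L) where
  left_distrib a b c := ext' (by simp [mul_add]) (fun l => by simp [add_mul])
  right_distrib a b c := ext' (by simp [add_mul]) (fun l => by simp)
  zero_mul a := ext' (by simp) (fun l => by simp)
  mul_zero a := ext' (by simp) (fun l => by simp)
  mul_assoc a b c := ext' (by simp [mul_assoc]) (fun l => by simp [mul_assoc])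

instance : IsScalarTower K (SemidirectRing K L) (SemidirectRing K L) :=
  ⟨fun c a b => ext' (by simp [smul_mul_assoc]) (fun l => by simp)⟩

instance : SMulCommClass K (SemidirectRing K L) (SemidirectRing K L) :=
  ⟨fun c a b => ext' (by simp [mul_smul_comm]) (fun l => by simp [smul_mul_assoc])⟩

/-- The Lie algebra `L ▷ L*`: the commutator bracket, so that `[H, H']` is the commutator of `L`,
`[H, ξ] = - ξ (H ·)` and `[ξ, ξ'] = 0`. -/
instance : LieRing (SemidirectRing K L) where
  bracket a b := a * b - b * a
  add_lie a b c := by simp only [add_mul, mul_add]; abel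
  lie_add a b c := by simp only [add_mul, mul_add]; abel
  lie_self a := by simp
  leibniz_lie a b c := by
    simp only [mul_sub, sub_mul, mul_assoc]; abel

variable {K L} in
lemma lie_def (a b : SemidirectRing K L) : ⁅a, b⁆ = a * b - b * a := rfl

instance : LieAlgebra K (SemidirectRing K L) where
  lie_smul c a b := by simp only [lie_def, mul_smul_comm, smul_mul_assoc, smul_sub]

end SemidirectRing

variable [IsScalarTower K L L] [SMulCommClass K L L]

/-- The ring `R`: the semidirect product of `L` and `L*` with an identity adjoined. -/
abbrev RingR : Type _ := Unitization K (SemidirectRing K L)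

/-- The universal enveloping algebra of the Lie algebra `L ▷ L*`. -/
abbrev EnvR : Type _ := UniversalEnvelopingAlgebra K (SemidirectRing K L)

end Ring

/-! ### The twisting equation in the tensor bialgebra `T(A)`

An element of `T(A)` is a family of elements of the tensor powers of `A`; an element `Φ` of the
(completed) tensor square of `T(A)` is a family `Φ m n` in `A^{⊗m} ⊗ A^{⊗n}`. The product is
componentwise, the coproduct is deconcatenation, the counit is the projection to `A^{⊗0}`. -/

section Twist

variable (K A : Type*) [Field K] [Ring A] [Algebra K A]

/-- The completed tensor square of `T(A)`. -/
abbrev TensorBialgebraSq : Type _ := ∀ m n : ℕ, (⨂[K]^m A) ⊗[K] (⨂[K]^n A)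

/-- The component `A^{⊗(m+n)} → A^{⊗m} ⊗ A^{⊗n}` of the coproduct of `T(A)`. -/
def deconcat (m n : ℕ) : (⨂[K]^(m + n) A) →ₗ[K] (⨂[K]^m A) ⊗[K] (⨂[K]^n A) :=
  (TensorPower.mulEquiv (R := K) (M := A) (n := m) (m := n)).symm.toLinearMap

variable {K A}

/-- `Φ` is invertible, normalized, and solves the twisting equation
`(Δ ⊗ id)(Φ) Φ₁₂ = (id ⊗ Δ)(Φ) Φ₂₃`. -/
structure IsTwistingCocycle (Φ : TensorBialgebraSq K A) : Prop where
  isUnit : IsUnit Φ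
  counit_left : ∀ n, Φ 0 n = 1
  counit_right : ∀ m, Φ m 0 = 1
  twist : ∀ m n k : ℕ,
    (deconcat K A m n).rTensor (⨂[K]^k A) (Φ (m + n) k) * (Φ m n ⊗ₜ[K] 1) =
      (TensorProduct.assoc K (⨂[K]^m A) (⨂[K]^n A) (⨂[K]^k A)).symm
          ((deconcat K A n k).lTensor (⨂[K]^m A) (Φ m (n + k))) *
        (TensorProduct.assoc K (⨂[K]^m A) (⨂[K]^n A) (⨂[K]^k A)).symm (1 ⊗ₜ[K] Φ n k)

/-- The ordered product `F₁₂ F₁₃ ⋯ F₁₍ₖ₊₁₎` in `A ⊗ A^{⊗k}` for `F` in `A ⊗ A`. -/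
def splitProduct (F : A ⊗[K] A) (k : ℕ) : (⨂[K]^1 A) ⊗[K] (⨂[K]^k A) :=
  (List.ofFn fun j : Fin k =>
    Algebra.TensorProduct.map
      (PiTensorProduct.singleAlgHom (R := K) (A := fun _ : Fin 1 => A) 0)
      (PiTensorProduct.singleAlgHom (R := K) (A := fun _ : Fin k => A) j) F).prod

/-- `Φ` is the twisting cocycle obtained from `F` in `A ⊗ A` by the modified Reshetikhin
procedure: the twisting cocycle with components `Φ^{1,k} = F₁₂ F₁₃ ⋯ F₁₍ₖ₊₁₎`. -/
structure IsReshetikhinExpansion (F : A ⊗[K] A) (Φ : TensorBialgebraSq K A) : Prop where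
  isTwistingCocycle : IsTwistingCocycle Φ
  one_apply : ∀ k, Φ 1 k = splitProduct F k

end Twist

section Rep

variable (K L : Type*) [Field K] [NonUnitalRing L] [Module K L]
  [IsScalarTower K L L] [SMulCommClass K L L]

attribute [local instance 100] LieRing.ofAssociativeRing

/-- The Lie algebra map `x ↦ ∑ᵢ 1 ⊗ ⋯ ⊗ x ⊗ ⋯ ⊗ 1` from `L ▷ L*` to `R^{⊗n}`. -/
def primitiveHom (n : ℕ) : SemidirectRing K L →ₗ⁅K⁆ (⨂[K]^n (RingR K L)) where
  toLinearMap := ∑ i : Fin n,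
    (PiTensorProduct.singleAlgHom (R := K) (A := fun _ : Fin n => RingR K L) i).toLinearMap ∘ₗ
      Unitization.inrHom K K (SemidirectRing K L)
  map_lie' {x y} := by
    have hc : ∀ i j : Fin n, i ≠ j → ∀ a b : RingR K L,
        Commute (PiTensorProduct.singleAlgHom (R := K) (A := fun _ : Fin n => RingR K L) i a)
          (PiTensorProduct.singleAlgHom (R := K) (A := fun _ : Fin n => RingR K L) j b) :=
      fun i j hij a b => Commute.tprod
        (Pi.mulSingle_commute (f := fun _ : Fin n => RingR K L) hij a b)
    have key : ∀ i : Fin n, ∑ j : Fin n,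
        (PiTensorProduct.singleAlgHom (R := K) (A := fun _ : Fin n => RingR K L) i (x : RingR K L) *
            PiTensorProduct.singleAlgHom (R := K) (A := fun _ : Fin n => RingR K L) j y -
          PiTensorProduct.singleAlgHom (R := K) (A := fun _ : Fin n => RingR K L) j y *
            PiTensorProduct.singleAlgHom (R := K) (A := fun _ : Fin n => RingR K L) i x) =
        PiTensorProduct.singleAlgHom (R := K) (A := fun _ : Fin n => RingR K L) i
          ((⁅x, y⁆ : SemidirectRing K L) : RingR K L) := by
      intro i
      rw [Finset.sum_eq_single i]
      · rw [SemidirectRing.lie_def, ← map_mul, ← map_mul, ← map_sub]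
        congr 1
        simp [Unitization.inr_mul, Unitization.inr_sub]
      · intro j _ hj
        exact sub_eq_zero.2 (hc i j (Ne.symm hj) _ _)
      · simp
    simp only [AddHom.toFun_eq_coe, LinearMap.coe_toAddHom, LinearMap.sum_apply,
      LinearMap.comp_apply, AlgHom.toLinearMap_apply, Unitization.inrHom_apply,
      LieRing.of_associative_ring_bracket]
    rw [Finset.sum_mul_sum, Finset.sum_mul_sum, Finset.sum_comm (f := fun i j =>
      PiTensorProduct.singleAlgHom (R := K) (A := fun _ : Fin n => RingR K L) i (y : RingR K L) *
        PiTensorProduct.singleAlgHom (R := K) (A := fun _ : Fin n => RingR K L) j x),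
      ← Finset.sum_sub_distrib]
    refine Finset.sum_congr rfl fun i _ => ?_
    rw [← Finset.sum_sub_distrib]
    exact (key i).symm

/-- The component in `R^{⊗n}` of the homomorphism from the universal enveloping algebra to
`T(R)` that extends the inclusions of `L` and `L*` in `R`. -/
def tensorRep (n : ℕ) : EnvR K L →ₐ[K] (⨂[K]^n (RingR K L)) :=
  UniversalEnvelopingAlgebra.lift K (primitiveHom K L n)

end Rep

section Completion

attribute [local instance 100] LieRing.ofAssociativeRing

variable {K L : Type*} [Field K] [NonUnitalRing L] [Module K L]
  [IsScalarTower K L L] [SMulCommClass K L L]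

/-- The element `1 ⊗ 1 - ∑ X^ν ⊗ H_ν` of `R ⊗ R`, where `H_ν` is a basis of `L` and `X^ν` is the
dual basis of `L*`. -/
def phiOneOne {ι : Type*} [Fintype ι] (b : Module.Basis ι K L) : RingR K L ⊗[K] RingR K L :=
  1 ⊗ₜ[K] 1 - ∑ ν,
    (SemidirectRing.ofX K L (b.coord ν) : RingR K L) ⊗ₜ[K] (SemidirectRing.ofH K L (b ν) : RingR K L)

variable (K L)

/-- `L → U(L ▷ L*)`. -/
def envH : L →ₗ[K] EnvR K L :=
  (UniversalEnvelopingAlgebra.ι K (L := SemidirectRing K L)).toLinearMap ∘ₗ SemidirectRing.ofH K L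

/-- `L* → U(L ▷ L*)`. -/
def envX : Module.Dual K L →ₗ[K] EnvR K L :=
  (UniversalEnvelopingAlgebra.ι K (L := SemidirectRing K L)).toLinearMap ∘ₗ SemidirectRing.ofX K L

/-- `U(L)`, the subalgebra generated by `L`. -/
def envL : Subalgebra K (EnvR K L) := Algebra.adjoin K (Set.range (envH K L))

/-- The homogeneous component of degree `d` of `U(L*)`: the span of the products of `d` elements
of `L*`. -/
def envLDual (d : ℕ) : Submodule K (EnvR K L) := (LinearMap.range (envX K L)) ^ d

variable {K L}

/-- The completion `∏_d U_d(L*)` of `U(L*)` is realized inside the formal power series in one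
variable over `U(L ▷ L*)`: the coefficient of index `d` is the term of degree `d`
in the elements of `L*`. -/
def IsSeriesInX (f : PowerSeries (EnvR K L)) : Prop :=
  ∀ d, PowerSeries.coeff d f ∈ envLDual K L d

/-- The completion `∏_d U_d(L*) ⊗ U(L)` of `U(L*) ⊗ U(L)`, realized in the same way. -/
def MemCompletedTensor (F : PowerSeries (EnvR K L ⊗[K] EnvR K L)) : Prop :=
  ∀ d, PowerSeries.coeff d F ∈
    LinearMap.range (TensorProduct.mapIncl (envLDual K L d) (envL K L).toSubmodule)

/-- `f ⊗ u` for a series `f`. -/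
def seriesTmul (f : PowerSeries (EnvR K L)) (u : EnvR K L) :
    PowerSeries (EnvR K L ⊗[K] EnvR K L) :=
  PowerSeries.mk fun d => PowerSeries.coeff d f ⊗ₜ[K] u

variable (K) in
/-- The exponential of a formal power series without constant term, over a possibly
noncommutative algebra. The powers of index above `d` do not contribute in degree `d`. -/
def seriesExp {A : Type*} [Ring A] [Algebra K A] (f : PowerSeries A) : PowerSeries A :=
  PowerSeries.mk fun d =>
    ∑ j ∈ Finset.range (d + 1), ((j.factorial : K)⁻¹) • PowerSeries.coeff d (f ^ j)

/-- The series `F` represents `Φ`: for all `m`, `n` the images in `R^{⊗m} ⊗ R^{⊗n}` of the terms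
of `F` sum up to `Φ m n`, the partial sums being eventually constant. -/
def Represents (F : PowerSeries (EnvR K L ⊗[K] EnvR K L))
    (Φ : TensorBialgebraSq K (RingR K L)) : Prop :=
  ∀ m n : ℕ, ∀ᶠ N in Filter.atTop,
    ∑ d ∈ Finset.range N,
      Algebra.TensorProduct.map (tensorRep K L m) (tensorRep K L n) (PowerSeries.coeff d F) = Φ m n

end Completion

end

open scoped TensorProduct

noncomputable section

/-! ### Ordered products in a ring -/

section OrderedProducts

variable {Q : Type*} [Ring Q]

/-! The cocycle can be written down in closed form. Let `X^ν` act on `R^{⊗m}` by the sum over all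
places, and put `c_j = ∑_ν X^ν ⊗ H_{ν,j}` with `H_ν` in the place `j` of `R^{⊗n}`. Then `Φ^{m,n} =
∏_j (1 - c_j)`, which for `m = 1` is the prescribed product.

Uniqueness (`IsReshetikhinExpansion.unique`): the twisting equation in degrees `(1, n, k)` expresses
`Φ^{1+n,k}` through `Φ^{1,n}`, `Φ^{1,n+k}` and `Φ^{n,k}`, because `Φ^{1,n}` is invertible and
deconcatenation is an isomorphism.

Twisting equation (`linProd_twist`): on the three tensor legs let `c_q`, `a_p`, `b_{qp}` be the
pairings of leg 1 with place `q` of leg 2, of leg 1 with place `p` of leg 3, and of place `q` of leg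
2 with place `p` of leg 3. The relations of `R` enter only through `c_q b_{qp} = 0`, from `H X = 0`,
and `b_{qp} c_q = a_p b_{qp}`, from the action of `L` on `L*`. The rest is the reordering of
products in `prod_one_sub_add_mul_prod_one_sub`.

Exponential form (`represents_seriesExp_logSeries`): since `H_{μ,j} H_{ν,j}` is computed in `L`,
`c_j^d = ∑_ν P_d^ν ⊗ H_{ν,j}`, where `P_d^ν` is the `ν`-th coordinate of the `d`-th power of a
generic element of `L` (`sum_powerCoord_tmul`). It does not depend on `j`, so `∑_j log (1 - c_j)` is
the image of `-∑_ν X̃^ν ⊗ H_ν` with `X̃^ν = ∑_d P_d^ν / d`. The `c_j` commute, hence the exponential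
of this sum is `∏_j (1 - c_j)`. -/

lemma mul_prod_one_sub_of_mem {κ : Type*} {c : κ → Q} {a b : Q} {q : κ}
    (hcc : ∀ j, Commute (c q) (c j)) (hac : ∀ j, Commute a (c j))
    (hbc : ∀ j, j ≠ q → Commute b (c j)) (h₀ : c q * b = 0) (h₁ : b * c q = a * b)
    {l : List κ} (hl : l.Nodup) (hq : q ∈ l) :
    b * (l.map fun j => 1 - c j).prod = (l.map fun j => 1 - c j).prod * ((1 - a) * b) := by
  induction l with
  | nil => simp at hq
  | cons j l ih =>
    rw [List.nodup_cons] at hl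
    simp only [List.map_cons, List.prod_cons]
    set P := (l.map fun j => 1 - c j).prod with hP
    -- Every factor other than `1 - c q` commutes with `b`, and `q` occurs only once, so the single
    -- factor `1 - c q` is responsible for the twist by `1 - a`.
    by_cases hj : j = q
    · subst hj
      have hPa : Commute a P := Commute.list_prod_right _ _ fun x hx => by
        obtain ⟨i, -, rfl⟩ := List.mem_map.1 hx
        exact (Commute.one_right _).sub_right (hac i)
      have hPb : Commute b P := Commute.list_prod_right _ _ fun x hx => by
        obtain ⟨i, hi, rfl⟩ := List.mem_map.1 hx
        exact (Commute.one_right _).sub_right (hbc i fun h => hl.1 (h ▸ hi))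
      have hPc : Commute (c j) P := Commute.list_prod_right _ _ fun x hx => by
        obtain ⟨i, -, rfl⟩ := List.mem_map.1 hx
        exact (Commute.one_right _).sub_right (hcc i)
      -- `c q` can be moved right until it meets `b` and kills it. So a factor `1 - c q` may be
      -- restored on the left of `P * ((1 - a) * b)` for free.
      have hz : c j * (P * ((1 - a) * b)) = 0 := by
        have h2 : Commute (c j) (1 - a) := (Commute.one_right _).sub_right (hac j).symm
        rw [← mul_assoc, hPc.eq, mul_assoc, ← mul_assoc (c j), h2.eq, mul_assoc, h₀, mul_zero,
          mul_zero]
      have hl' : b * ((1 - c j) * P) = (1 - a) * b * P := by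
        rw [← mul_assoc, mul_sub, mul_one, h₁, sub_mul 1 a b, one_mul]
      rw [hl', mul_assoc, hPb.eq, ← mul_assoc,
        ((Commute.one_left P).sub_left hPa).eq, mul_assoc, mul_assoc, sub_mul 1 (c j), one_mul, hz,
        sub_zero]
    · have hq' : q ∈ l := by simpa [Ne.symm hj] using hq
      rw [← mul_assoc, ((Commute.one_right b).sub_right (hbc j hj)).eq, mul_assoc, ih hl.2 hq',
        mul_assoc]

lemma prod_map_mul_of_commute {κ : Type*} {u v : κ → Q} {l : List κ} (hl : l.Nodup)
    (h : ∀ i j, i ≠ j → Commute (u i) (v j)) :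
    (l.map fun i => u i * v i).prod = (l.map u).prod * (l.map v).prod := by
  induction l with
  | nil => simp
  | cons j l ih =>
    rw [List.nodup_cons] at hl
    simp only [List.map_cons, List.prod_cons, ih hl.2]
    have : Commute (v j) (l.map u).prod := Commute.list_prod_right _ _ fun x hx => by
      obtain ⟨i, hi, rfl⟩ := List.mem_map.1 hx
      exact (h i j fun e => hl.1 (e ▸ hi)).symm
    rw [mul_assoc, ← mul_assoc (v j), this.eq]
    simp only [mul_assoc]

lemma prod_map_mul_eq_mul_prod_map {κ : Type*} {u v : κ → Q} {g : Q}
    (h : ∀ i, u i * g = g * v i) (l : List κ) : (l.map u).prod * g = g * (l.map v).prod := by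
  induction l with
  | nil => simp
  | cons j l ih => simp only [List.map_cons, List.prod_cons]; rw [mul_assoc, ih, ← mul_assoc, h,
      mul_assoc]

/-- Moving `g = ∏ (1 - c q)` to the left turns each `b q p` into `(1 - a p) * b q p`, so the factor
`1 - a p - ∑ b q p` becomes `(1 - a p) * (1 - ∑ b q p)`. As `a p` commutes with `b q p'` for `p ≠
p'`, the two kinds of factors can then be separated. -/
lemma prod_one_sub_add_mul_prod_one_sub {n k : ℕ} {c : Fin n → Q} {a : Fin k → Q}
    {b : Fin n → Fin k → Q}
    (hcc : ∀ i j, Commute (c i) (c j)) (hac : ∀ p j, Commute (a p) (c j))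
    (hbc : ∀ q p j, j ≠ q → Commute (b q p) (c j)) (hab : ∀ p q p', p ≠ p' → Commute (a p) (b q p'))
    (h₀ : ∀ q p, c q * b q p = 0) (h₁ : ∀ q p, b q p * c q = a p * b q p) :
    (List.ofFn fun p => 1 - (a p + ∑ q, b q p)).prod * (List.ofFn fun q => 1 - c q).prod =
      ((List.ofFn fun q => 1 - c q).prod * (List.ofFn fun p => 1 - a p).prod) *
        (List.ofFn fun p => 1 - ∑ q, b q p).prod := by
  simp only [List.ofFn_eq_map]
  set g := ((List.finRange n).map fun q => 1 - c q).prod with hg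
  have hag : ∀ p, Commute (a p) g := fun p => Commute.list_prod_right _ _ fun x hx => by
    obtain ⟨i, -, rfl⟩ := List.mem_map.1 hx
    exact (Commute.one_right _).sub_right (hac p i)
  have hbg : ∀ q p, b q p * g = g * ((1 - a p) * b q p) := fun q p =>
    mul_prod_one_sub_of_mem (hcc q) (hac p) (hbc q p) (h₀ q p) (h₁ q p) (List.nodup_finRange n)
      (List.mem_finRange q)
  rw [prod_map_mul_eq_mul_prod_map (g := g) (v := fun p => (1 - a p) * (1 - ∑ q, b q p)),
    prod_map_mul_of_commute (List.nodup_finRange k), mul_assoc]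
  · intro i j hij
    refine ((Commute.one_left _).sub_left ?_)
    exact (Commute.one_right _).sub_right (Commute.sum_right _ _ _ fun q _ => hab i q j hij)
  · intro p
    rw [sub_mul, add_mul, Finset.sum_mul, Finset.sum_congr rfl fun q _ => hbg q p, ← Finset.mul_sum,
      ← Finset.mul_sum, (hag p).eq]
    noncomm_ring

end OrderedProducts

/-! ### The exponential of a power series -/

section Exp

variable {K : Type*} [Field K]

lemma map_seriesExp {A B : Type*} [Ring A] [Algebra K A] [Ring B] [Algebra K B] (θ : A →ₐ[K] B)
    (f : PowerSeries A) :
    PowerSeries.map (θ : A →+* B) (seriesExp K f) =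
      seriesExp K (PowerSeries.map (θ : A →+* B) f) := by
  ext d
  simp only [seriesExp, PowerSeries.coeff_map, PowerSeries.coeff_mk, ← map_pow, map_sum]
  simp

lemma coeff_pow_eq_zero_of_lt {A : Type*} [Ring A] {f : PowerSeries A}
    (hf : PowerSeries.constantCoeff f = 0) {d j : ℕ} (h : d < j) :
    PowerSeries.coeff d (f ^ j) = 0 := by
  induction j generalizing d with
  | zero => simp at h
  | succ j ih =>
    rw [pow_succ, PowerSeries.coeff_mul]
    refine Finset.sum_eq_zero fun x hx => ?_
    rw [Finset.HasAntidiagonal.mem_antidiagonal] at hx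
    by_cases hx2 : x.2 = 0
    · rw [hx2, PowerSeries.coeff_zero_eq_constantCoeff_apply, hf, mul_zero]
    · rw [ih (by omega), zero_mul]

lemma coeff_seriesExp {A : Type*} [Ring A] [Algebra K A] {f : PowerSeries A}
    (hf : PowerSeries.constantCoeff f = 0) {d N : ℕ} (h : d < N) :
    PowerSeries.coeff d (seriesExp K f) =
      PowerSeries.coeff d (∑ j ∈ Finset.range N, ((j.factorial : K)⁻¹) • f ^ j) := by
  simp only [seriesExp, PowerSeries.coeff_mk, map_sum, PowerSeries.coeff_smul]
  refine Finset.sum_subset (Finset.range_subset_range.2 h) fun j _ hj => ?_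
  rw [coeff_pow_eq_zero_of_lt hf (by simpa using hj), smul_zero]

variable [CharZero K] {C : Type*} [CommRing C] [Algebra K C]

/-- The derivative of the exponential sum truncated after `N + 1` terms is `f'` times the sum of `N`
terms. Each coefficient sees only finitely many terms, so this passes to the full series. -/
lemma derivative_seriesExp {f : PowerSeries C} (hf : PowerSeries.constantCoeff f = 0) :
    PowerSeries.derivative C (seriesExp K f) =
      PowerSeries.derivative C f * seriesExp K f := by
  have key : ∀ N, PowerSeries.derivative C
      (∑ j ∈ Finset.range (N + 1), ((j.factorial : K)⁻¹) • f ^ j) =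
      PowerSeries.derivative C f * ∑ j ∈ Finset.range N, ((j.factorial : K)⁻¹) • f ^ j := by
    intro N
    rw [Finset.sum_range_succ']
    have hs : ∀ (r : K) (g : PowerSeries C),
        PowerSeries.derivative C (r • g) = r • PowerSeries.derivative C g := fun r g => by
      ext d
      simp only [PowerSeries.coeff_derivative, PowerSeries.coeff_smul, smul_mul_assoc]
    rw [map_add, map_sum, hs, pow_zero, PowerSeries.derivative_one, smul_zero, add_zero,
      Finset.mul_sum]
    refine Finset.sum_congr rfl fun j _ => ?_
    rw [hs, PowerSeries.derivative_pow, Nat.add_sub_cancel, Nat.factorial_succ, Nat.cast_mul,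
      mul_inv_rev, mul_smul, mul_assoc, ← nsmul_eq_mul, ← Nat.cast_smul_eq_nsmul K,
      smul_smul _ _ (f ^ j * _), inv_mul_cancel₀ (Nat.cast_ne_zero.2 j.succ_ne_zero), one_smul,
      mul_smul_comm, mul_comm]
  ext d
  rw [PowerSeries.coeff_derivative, coeff_seriesExp hf (show d + 1 < d + 2 by omega),
    ← PowerSeries.coeff_derivative, key, PowerSeries.coeff_mul, PowerSeries.coeff_mul]
  refine Finset.sum_congr rfl fun x hx => ?_
  rw [Finset.HasAntidiagonal.mem_antidiagonal] at hx
  rw [coeff_seriesExp hf (show x.2 < d + 1 by omega)]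

/-- The equation `y' = h y` gives `(d + 1) y_{d+1}` in terms of the coefficients of `y` up to `d`,
and `d + 1` can be cancelled. -/
lemma eq_of_derivative_eq_mul {C : Type*} [CommRing C] (hu : ∀ d : ℕ, IsUnit ((d : C) + 1))
    {E P h : PowerSeries C}
    (hE : PowerSeries.derivative C E = h * E) (hP : PowerSeries.derivative C P = h * P)
    (h₀ : PowerSeries.constantCoeff E = PowerSeries.constantCoeff P) : E = P := by
  ext d
  induction d using Nat.strong_induction_on with
  | _ d ih =>
    cases d with
    | zero => simpa using h₀
    | succ d =>
      apply (hu d).mul_left_injective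
      simp only
      rw [← PowerSeries.coeff_derivative, ← PowerSeries.coeff_derivative, hE, hP,
        PowerSeries.coeff_mul, PowerSeries.coeff_mul]
      refine Finset.sum_congr rfl fun x hx => ?_
      rw [Finset.HasAntidiagonal.mem_antidiagonal] at hx
      rw [ih x.2 (by omega)]

/-- The logarithmic derivative of `1 - c t` is `-∑ c^(d+1) t^d`, and logarithmic derivatives add up
over a product. -/
lemma derivative_prod_one_sub {κ : Type*} (s : Finset κ) (c : κ → C) :
    PowerSeries.derivative C (∏ j ∈ s, (1 - PowerSeries.C (c j) * PowerSeries.X)) =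
      (PowerSeries.mk fun d => -∑ j ∈ s, c j ^ (d + 1)) *
        ∏ j ∈ s, (1 - PowerSeries.C (c j) * PowerSeries.X) := by
  classical
  induction s using Finset.induction_on with
  | empty =>
    rw [Finset.prod_empty, Derivation.map_one_eq_zero]
    ext; simp
  | insert j s hj ih =>
    have h1 : PowerSeries.derivative C (1 - PowerSeries.C (c j) * PowerSeries.X) =
        (PowerSeries.mk fun d => -c j ^ (d + 1)) * (1 - PowerSeries.C (c j) * PowerSeries.X) := by
      ext d
      rw [mul_sub, mul_one, mul_left_comm, map_sub, map_sub, map_sub,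
        PowerSeries.coeff_C_mul (R := C) _ _ (c j)]
      cases d with
      | zero => simp
      | succ d =>
        rw [PowerSeries.coeff_succ_mul_X]
        simp
        ring
    have h2 : (PowerSeries.mk fun d => -∑ i ∈ insert j s, c i ^ (d + 1)) =
        (PowerSeries.mk fun d => -c j ^ (d + 1)) +
          PowerSeries.mk fun d => -∑ i ∈ s, c i ^ (d + 1) := by
      ext d
      simp [Finset.sum_insert hj]
      ring
    rw [Finset.prod_insert hj, Derivation.leibniz, h1, ih, h2, smul_eq_mul, smul_eq_mul]
    ring

/-- Here `f` is `∑ log (1 - c_j t)`. Both sides solve `y' = f' y` with constant term `1`. -/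
lemma seriesExp_eq_prod_one_sub {κ : Type*} [Fintype κ] (c : κ → C) {f : PowerSeries C}
    (hf₀ : PowerSeries.constantCoeff f = 0)
    (hf : ∀ d, PowerSeries.coeff (d + 1) f = -(((d + 1 : ℕ) : K)⁻¹ • ∑ j, c j ^ (d + 1))) :
    seriesExp K f = ∏ j, (1 - PowerSeries.C (c j) * PowerSeries.X) := by
  have hu : ∀ d : ℕ, IsUnit ((d : C) + 1) := fun d => by
    simpa using (IsUnit.mk0 ((d : K) + 1) (Nat.cast_add_one_ne_zero d)).map (algebraMap K C)
  refine eq_of_derivative_eq_mul hu (derivative_seriesExp hf₀) ?_ ?_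
  · rw [derivative_prod_one_sub]
    congr 1
    ext d
    rw [PowerSeries.coeff_derivative, hf, PowerSeries.coeff_mk, neg_mul, smul_mul_assoc, mul_comm]
    have : ((d : C) + 1) = algebraMap K C ((d + 1 : ℕ) : K) := by simp
    rw [this, ← Algebra.smul_def, smul_smul, inv_mul_cancel₀ (Nat.cast_ne_zero.2 d.succ_ne_zero),
      one_smul]
  · rw [map_prod, ← PowerSeries.coeff_zero_eq_constantCoeff_apply]
    simp [seriesExp]

variable {Q : Type*} [Ring Q] [Algebra K Q]

/-- The series is a polynomial in `t`, and its value at `t = 1` is reached by the partial sums of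
its coefficients. -/
lemma eventually_sum_coeff_prod_one_sub (l : List Q) :
    ∀ᶠ N in Filter.atTop, ∑ d ∈ Finset.range N,
      PowerSeries.coeff d (l.map fun c => 1 - PowerSeries.C c * PowerSeries.X).prod =
        (l.map fun c => 1 - c).prod := by
  induction l with
  | nil =>
    filter_upwards [Filter.eventually_ge_atTop 1] with N hN
    simp only [List.map_nil, List.prod_nil, PowerSeries.coeff_one]
    rw [Finset.sum_ite_eq' (Finset.range N) 0 (fun _ => (1 : Q)), if_pos (Finset.mem_range.2 hN)]
  | cons c l ih =>
    obtain ⟨N₀, hN₀⟩ := Filter.eventually_atTop.1 ih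
    -- Multiplication by `c t` shifts degrees by one, so the partial sums of lengths `N` and `N - 1`
    -- must both be stable.
    filter_upwards [Filter.eventually_ge_atTop (N₀ + 1)] with N hN
    obtain ⟨M, rfl⟩ : ∃ M, N = M + 1 := ⟨N - 1, by omega⟩
    simp only [List.map_cons, List.prod_cons, sub_mul, one_mul, map_sub, Finset.sum_sub_distrib]
    rw [hN₀ (M + 1) (by omega), Finset.sum_range_succ']
    congr 1
    simp only [mul_assoc, PowerSeries.coeff_C_mul, PowerSeries.coeff_succ_X_mul]
    rw [← Finset.mul_sum, hN₀ M (by omega)]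
    simp

/-- The differential equation argument needs a commutative ring. The commuting `c j` generate a
commutative subalgebra that contains all coefficients of `f`; the identity is proved there and
mapped to `Q`. -/
lemma eventually_sum_coeff_seriesExp {n : ℕ} (c : Fin n → Q) (hc : ∀ i j, Commute (c i) (c j))
    {f : PowerSeries Q} (hf₀ : PowerSeries.constantCoeff f = 0)
    (hf : ∀ d, PowerSeries.coeff (d + 1) f = -(((d + 1 : ℕ) : K)⁻¹ • ∑ j, c j ^ (d + 1))) :
    ∀ᶠ N in Filter.atTop, ∑ d ∈ Finset.range N, PowerSeries.coeff d (seriesExp K f) =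
      (List.ofFn fun j => 1 - c j).prod := by
  have hcomm : ∀ a ∈ Set.range c, ∀ b ∈ Set.range c, a * b = b * a := by
    rintro _ ⟨i, rfl⟩ _ ⟨j, rfl⟩
    exact hc i j
  let S := Algebra.adjoin K (Set.range c)
  have : IsMulCommutative (Algebra.adjoin K (Set.range c)) :=
    Algebra.isMulCommutative_adjoin K hcomm
  let : CommRing S := { (inferInstance : Ring S) with mul_comm := this.is_comm.comm }
  let c' : Fin n → S := fun j => ⟨c j, Algebra.subset_adjoin ⟨j, rfl⟩⟩
  let f' : PowerSeries S := PowerSeries.mk fun d =>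
    Nat.casesOn d 0 fun d => -(((d + 1 : ℕ) : K)⁻¹ • ∑ j, c' j ^ (d + 1))
  have hf' : PowerSeries.map (S.val : S →+* Q) f' = f := by
    ext d
    cases d with
    | zero => simp [f', hf₀]
    | succ d => simp [f', hf, c']
  have h := seriesExp_eq_prod_one_sub (K := K) c' (f := f') (by simp [f']) (fun d => by simp [f'])
  rw [← hf', ← map_seriesExp, h, ← List.prod_ofFn, map_list_prod, List.map_ofFn]
  have h2 := eventually_sum_coeff_prod_one_sub (List.ofFn c)
  simp only [List.map_ofFn] at h2
  have h3 : (⇑(PowerSeries.map (S.val : S →+* Q)) ∘ fun j =>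
      1 - PowerSeries.C (c' j) * PowerSeries.X) =
      (fun c => 1 - PowerSeries.C c * PowerSeries.X) ∘ c := by
    funext j; simp [c']
  rw [h3]
  exact h2

end Exp

/-! ### Deconcatenation as an isomorphism of algebras -/

section Deconcat

variable (K A : Type*) [Field K] [Ring A] [Algebra K A]

lemma mulEquiv_tprod_tmul_tprod {m n : ℕ} (a : Fin m → A) (b : Fin n → A) :
    TensorPower.mulEquiv (R := K) (PiTensorProduct.tprod K a ⊗ₜ[K] PiTensorProduct.tprod K b) =
      PiTensorProduct.tprod K (Fin.append a b) := by
  rw [← TensorPower.gMul_def, TensorPower.tprod_mul_tprod]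

lemma append_mul_append {m n : ℕ} (a a' : Fin m → A) (b b' : Fin n → A) :
    Fin.append (a * a') (b * b') = Fin.append a b * Fin.append a' b' := by
  funext i
  refine Fin.addCases (fun i => ?_) (fun i => ?_) i <;> simp

/-- The component `A^{⊗(m+n)} → A^{⊗m} ⊗ A^{⊗n}` of the coproduct of `T(A)` as an isomorphism of
algebras. -/
def deconcatEquiv (m n : ℕ) : (⨂[K]^(m + n) A) ≃ₐ[K] (⨂[K]^m A) ⊗[K] (⨂[K]^n A) :=
  (Algebra.TensorProduct.algEquivOfLinearEquivTensorProduct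
    (TensorPower.mulEquiv (R := K) (M := A) (n := m) (m := n))
    (fun a₁ a₂ b₁ b₂ => by
      induction a₁ using PiTensorProduct.induction_on with
      | add x y hx hy => simp only [add_mul, TensorProduct.add_tmul, map_add, hx, hy]
      | smul_tprod r a₁ =>
      induction a₂ using PiTensorProduct.induction_on with
      | add x y hx hy => simp only [mul_add, TensorProduct.add_tmul, map_add, hx, hy]
      | smul_tprod r a₂ =>
      induction b₁ using PiTensorProduct.induction_on with
      | add x y hx hy => simp only [add_mul, TensorProduct.tmul_add, map_add, hx, hy]
      | smul_tprod r b₁ =>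
      induction b₂ using PiTensorProduct.induction_on with
      | add x y hx hy => simp only [mul_add, TensorProduct.tmul_add, map_add, hx, hy]
      | smul_tprod r b₂ =>
      simp only [smul_mul_assoc, mul_smul_comm, TensorProduct.tmul_smul, ← TensorProduct.smul_tmul',
        map_smul, PiTensorProduct.tprod_mul_tprod, mulEquiv_tprod_tmul_tprod, append_mul_append]
      simp only [smul_smul, mul_comm, mul_left_comm])
    (by
      rw [PiTensorProduct.one_def, PiTensorProduct.one_def, mulEquiv_tprod_tmul_tprod]
      congr 1
      funext i
      refine Fin.addCases (fun i => ?_) (fun i => ?_) i <;> simp)).symm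

variable {K A}

lemma deconcatEquiv_tprod_append {m n : ℕ} (a : Fin m → A) (b : Fin n → A) :
    deconcatEquiv K A m n (PiTensorProduct.tprod K (Fin.append a b)) =
      PiTensorProduct.tprod K a ⊗ₜ[K] PiTensorProduct.tprod K b := by
  rw [← mulEquiv_tprod_tmul_tprod]
  exact LinearEquiv.symm_apply_apply (TensorPower.mulEquiv (R := K) (M := A) (n := m) (m := n)) _

/-- The inclusion of `A` in the place `i` of `A^{⊗n}`. -/
abbrev place (K : Type*) {A : Type*} [Field K] [Ring A] [Algebra K A] {n : ℕ} (i : Fin n) :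
    A →ₐ[K] ⨂[K]^n A :=
  PiTensorProduct.singleAlgHom (R := K) (A := fun _ : Fin n => A) i

lemma place_apply {n : ℕ} (i : Fin n) (a : A) :
    place K i a = PiTensorProduct.tprod K (Pi.mulSingle i a) := rfl

lemma commute_place {n : ℕ} {i j : Fin n} (h : i ≠ j) (a b : A) :
    Commute (place K i a) (place K j b) :=
  Commute.tprod (Pi.mulSingle_commute (f := fun _ : Fin n => A) h a b)

lemma deconcatEquiv_place_castAdd {m n : ℕ} (i : Fin m) (a : A) :
    deconcatEquiv K A m n (place K (Fin.castAdd n i) a) = place K i a ⊗ₜ[K] 1 := by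
  have : (Pi.mulSingle (Fin.castAdd n i) a : Fin (m + n) → A) =
      Fin.append (Pi.mulSingle i a) 1 := by
    funext j
    refine Fin.addCases (fun j => ?_) (fun j => ?_) j
    · simp [Pi.mulSingle_apply]
    · simp only [Fin.append_right, Pi.one_apply]
      refine Pi.mulSingle_eq_of_ne (M := fun _ => A) ?_ a
      simp [Fin.ext_iff]
      omega
  rw [place_apply, this, deconcatEquiv_tprod_append]
  rfl

lemma deconcatEquiv_place_natAdd {m n : ℕ} (i : Fin n) (a : A) :
    deconcatEquiv K A m n (place K (Fin.natAdd m i) a) = 1 ⊗ₜ[K] place K i a := by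
  have : (Pi.mulSingle (Fin.natAdd m i) a : Fin (m + n) → A) =
      Fin.append 1 (Pi.mulSingle i a) := by
    funext j
    refine Fin.addCases (fun j => ?_) (fun j => ?_) j
    · simp only [Fin.append_left, Pi.one_apply]
      refine Pi.mulSingle_eq_of_ne (M := fun _ => A) ?_ a
      simp [Fin.ext_iff]
      omega
    · simp [Pi.mulSingle_apply]
  rw [place_apply, this, deconcatEquiv_tprod_append]
  rfl

/-- `Δ ⊗ id` on the components of degree `(m + n, k)`, as an isomorphism of algebras. -/
def deconcatLeft (K A : Type*) [Field K] [Ring A] [Algebra K A] (m n k : ℕ) :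
    (⨂[K]^(m + n) A) ⊗[K] (⨂[K]^k A) ≃ₐ[K] ((⨂[K]^m A) ⊗[K] (⨂[K]^n A)) ⊗[K] (⨂[K]^k A) :=
  Algebra.TensorProduct.congr (deconcatEquiv K A m n) AlgEquiv.refl

/-- `id ⊗ Δ` on the components of degree `(m, n + k)`, as an isomorphism of algebras. -/
def deconcatRight (K A : Type*) [Field K] [Ring A] [Algebra K A] (m n k : ℕ) :
    (⨂[K]^m A) ⊗[K] (⨂[K]^(n + k) A) ≃ₐ[K] ((⨂[K]^m A) ⊗[K] (⨂[K]^n A)) ⊗[K] (⨂[K]^k A) :=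
  (Algebra.TensorProduct.congr AlgEquiv.refl (deconcatEquiv K A n k)).trans
    (Algebra.TensorProduct.assoc K K K (⨂[K]^m A) (⨂[K]^n A) (⨂[K]^k A)).symm

/-- `Φ ↦ Φ₂₃`. -/
def includeTwoThree (K A : Type*) [Field K] [Ring A] [Algebra K A] (m n k : ℕ) :
    (⨂[K]^n A) ⊗[K] (⨂[K]^k A) →ₐ[K] ((⨂[K]^m A) ⊗[K] (⨂[K]^n A)) ⊗[K] (⨂[K]^k A) :=
  (Algebra.TensorProduct.assoc K K K (⨂[K]^m A) (⨂[K]^n A) (⨂[K]^k A)).symm.toAlgHom.comp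
    Algebra.TensorProduct.includeRight

/-- The linear maps of the twisting equation are replaced by the algebra maps underlying them, so
that they can be applied to products factor by factor. -/
lemma twist_iff (Φ : TensorBialgebraSq K A) (m n k : ℕ) :
    (deconcat K A m n).rTensor (⨂[K]^k A) (Φ (m + n) k) * (Φ m n ⊗ₜ[K] 1) =
      (TensorProduct.assoc K (⨂[K]^m A) (⨂[K]^n A) (⨂[K]^k A)).symm
          ((deconcat K A n k).lTensor (⨂[K]^m A) (Φ m (n + k))) *
        (TensorProduct.assoc K (⨂[K]^m A) (⨂[K]^n A) (⨂[K]^k A)).symm (1 ⊗ₜ[K] Φ n k) ↔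
    deconcatLeft K A m n k (Φ (m + n) k) *
        (Algebra.TensorProduct.includeLeft : _ →ₐ[K] _ ⊗[K] (⨂[K]^k A)) (Φ m n) =
      deconcatRight K A m n k (Φ m (n + k)) * includeTwoThree K A m n k (Φ n k) :=
  Iff.rfl

/-! ### Uniqueness -/

lemma IsReshetikhinExpansion.unique {F : A ⊗[K] A} {Φ Ψ : TensorBialgebraSq K A}
    (hΦ : IsReshetikhinExpansion F Φ) (hΨ : IsReshetikhinExpansion F Ψ) : Φ = Ψ := by
  funext m
  induction m with
  | zero =>
    funext n
    rw [hΦ.isTwistingCocycle.counit_left, hΨ.isTwistingCocycle.counit_left]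
  | succ n ih =>
    suffices h : ∀ k, Φ (1 + n) k = Ψ (1 + n) k by
      rw [Nat.add_comm n 1]
      exact funext h
    intro k
    have h₁ := (twist_iff Φ 1 n k).1 (hΦ.isTwistingCocycle.twist 1 n k)
    have h₂ := (twist_iff Ψ 1 n k).1 (hΨ.isTwistingCocycle.twist 1 n k)
    rw [hΦ.one_apply, hΦ.one_apply, ih] at h₁
    rw [hΨ.one_apply, hΨ.one_apply, ← h₁] at h₂
    have hu : IsUnit (splitProduct F n) := by
      rw [← hΦ.one_apply]
      exact Pi.isUnit_iff.1 (Pi.isUnit_iff.1 hΦ.isTwistingCocycle.isUnit 1) n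
    -- Both `Φ (1 + n) k` and `Ψ (1 + n) k` give the same right-hand side. Cancel the unit `Φ 1 n`,
    -- then the isomorphism `Δ ⊗ id`.
    exact ((deconcatLeft K A 1 n k).injective ((hu.map _).mul_left_injective h₂)).symm

/-- The recursion used for uniqueness also propagates invertibility from `Φ 1 n` to all components.
-/
lemma isUnit_of_twist {Φ : TensorBialgebraSq K A} (h₀ : ∀ n, Φ 0 n = 1)
    (h₁ : ∀ n, IsUnit (Φ 1 n))
    (h : ∀ n k, deconcatLeft K A 1 n k (Φ (1 + n) k) *
        (Algebra.TensorProduct.includeLeft : _ →ₐ[K] _ ⊗[K] (⨂[K]^k A)) (Φ 1 n) =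
      deconcatRight K A 1 n k (Φ 1 (n + k)) * includeTwoThree K A 1 n k (Φ n k)) :
    IsUnit Φ := by
  refine Pi.isUnit_iff.2 fun m => Pi.isUnit_iff.2 ?_
  induction m with
  | zero => exact fun n => h₀ n ▸ isUnit_one
  | succ n ih =>
    rw [Nat.add_comm n 1]
    intro k
    have ihk : IsUnit (Φ n k) := ih k
    have hr₁ : IsUnit (deconcatRight K A 1 n k (Φ 1 (n + k))) := (h₁ (n + k)).map _
    have hr₂ : IsUnit (includeTwoThree K A 1 n k (Φ n k)) :=
      RingHom.isUnit_map (includeTwoThree K A 1 n k).toRingHom ihk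
    have hr := hr₁.mul hr₂
    rw [← h n k] at hr
    have hl := (h₁ n).map (Algebra.TensorProduct.includeLeft : _ →ₐ[K] _ ⊗[K] (⨂[K]^k A))
    rw [← hl.unit_spec, Units.isUnit_mul_units] at hr
    have hs := hr.map (deconcatLeft K A 1 n k).symm
    rwa [AlgEquiv.symm_apply_apply] at hs

end Deconcat

/-! ### The twisting cocycle -/

section Cocycle

variable {K L : Type*} [Field K] [NonUnitalRing L] [Module K L]
  {A : Type*} [Ring A] [Algebra K A]

/-- Linear maps from `L*` and `L` to an algebra that satisfy the relations of the semidirect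
product of `L` and `L*`. -/
structure IsSemidirectPair [SMulCommClass K L L] (X : Module.Dual K L →ₗ[K] A)
    (H : L →ₗ[K] A) : Prop where
  H_mul_H : ∀ h h', H h * H h' = H (h * h')
  X_mul_H : ∀ ξ h, X ξ * H h = X (ξ ∘ₗ LinearMap.mulLeft K h)
  H_mul_X : ∀ h ξ, H h * X ξ = 0
  X_mul_X : ∀ ξ ξ', X ξ * X ξ' = 0

variable {ι : Type*} (b : Module.Basis ι K L)

/-- The sum over the places of `A^{⊗m}` of the dual basis. -/
def sumX (X : Module.Dual K L →ₗ[K] A) (m : ℕ) (ν : ι) : ⨂[K]^m A :=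
  ∑ i : Fin m, place K i (X (b.coord ν))

lemma commute_sumX [SMulCommClass K L L] {X : Module.Dual K L →ₗ[K] A}
    {H : L →ₗ[K] A}
    (hXH : IsSemidirectPair X H) (m : ℕ) (ν μ : ι) : Commute (sumX b X m ν) (sumX b X m μ) :=
  Commute.sum_left _ _ _ fun i _ => Commute.sum_right _ _ _ fun j _ => by
    by_cases h : i = j
    · rw [h, Commute, SemiconjBy, ← map_mul (place K j), ← map_mul (place K j), hXH.X_mul_X,
        hXH.X_mul_X]
    · exact commute_place h _ _

lemma deconcatEquiv_sumX (X : Module.Dual K L →ₗ[K] A) (m n : ℕ) (ν : ι) :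
    deconcatEquiv K A m n (sumX b X (m + n) ν) =
      sumX b X m ν ⊗ₜ[K] 1 + 1 ⊗ₜ[K] sumX b X n ν := by
  rw [sumX, Fin.sum_univ_add, map_add, map_sum, map_sum]
  simp only [deconcatEquiv_place_castAdd, deconcatEquiv_place_natAdd]
  rw [← TensorProduct.sum_tmul, ← TensorProduct.tmul_sum]
  rfl

variable [Fintype ι]

/-- The canonical element `∑ X^ν ⊗ H_ν` does not distinguish `T` on the factor `L` from its
transpose on `L*`. -/
lemma sum_coord_comp_mul {Q : Type*} [Ring Q] [Algebra K Q] (f : Module.Dual K L →ₗ[K] Q)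
    (g : L →ₗ[K] Q) (T : L →ₗ[K] L) :
    ∑ ν, f (b.coord ν ∘ₗ T) * g (b ν) = ∑ ν, f (b.coord ν) * g (T (b ν)) := by
  have h₁ : ∀ ν, b.coord ν ∘ₗ T = ∑ σ, b.coord ν (T (b σ)) • b.coord σ := fun ν =>
    (b.sum_dual_apply_smul_coord (b.coord ν ∘ₗ T)).symm
  have h₂ : ∀ ν, T (b ν) = ∑ σ, b.coord σ (T (b ν)) • b σ := fun ν => (b.sum_repr (T (b ν))).symm
  calc ∑ ν, f (b.coord ν ∘ₗ T) * g (b ν)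
      = ∑ ν, ∑ σ, b.coord ν (T (b σ)) • (f (b.coord σ) * g (b ν)) := by
        refine Finset.sum_congr rfl fun ν _ => ?_
        rw [h₁, map_sum, Finset.sum_mul]
        exact Finset.sum_congr rfl fun σ _ => by rw [map_smul, smul_mul_assoc]
    _ = ∑ ν, f (b.coord ν) * g (T (b ν)) := by
        rw [Finset.sum_comm]
        refine Finset.sum_congr rfl fun ν _ => ?_
        conv_rhs => rw [h₂, map_sum, Finset.mul_sum]
        exact Finset.sum_congr rfl fun σ _ => by rw [map_smul, mul_smul_comm]

/-! ### Products of linear factors and the twisting equation -/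

section LinProd

variable {Q : Type*} [Ring Q] [Algebra K Q]

/-- The ordered product of the elements `1 - ∑ u_ν H_ν`, with `H_ν` in the places `e j`. -/
def linProd (H : L →ₗ[K] A) (u : ι → Q) {n : ℕ} (e : Fin n → A →ₐ[K] Q) : Q :=
  (List.ofFn fun j => 1 - ∑ ν, u ν * e j (H (b ν))).prod

lemma map_linProd (H : L →ₗ[K] A) {Q' : Type*} [Ring Q'] [Algebra K Q'] (θ : Q →ₐ[K] Q')
    (u : ι → Q) {n : ℕ} (e : Fin n → A →ₐ[K] Q) :
    θ (linProd b H u e) = linProd b H (fun ν => θ (u ν)) fun j => θ.comp (e j) := by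
  rw [linProd, map_list_prod, List.map_ofFn, linProd]
  congr 2
  funext j
  simp

lemma linProd_append (H : L →ₗ[K] A) (u : ι → Q) {n k : ℕ} (e : Fin n → A →ₐ[K] Q)
    (e' : Fin k → A →ₐ[K] Q) :
    linProd b H u (Fin.append e e') = linProd b H u e * linProd b H u e' := by
  rw [linProd, List.ofFn_add, List.prod_append]
  simp [linProd]

lemma commute_sum_mul {u v u' v' : ι → Q} (h₁ : ∀ ν μ, Commute (u ν) (u' μ))
    (h₂ : ∀ ν μ, Commute (u ν) (v' μ)) (h₃ : ∀ ν μ, Commute (v ν) (u' μ))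
    (h₄ : ∀ ν μ, Commute (v ν) (v' μ)) :
    Commute (∑ ν, u ν * v ν) (∑ μ, u' μ * v' μ) :=
  Commute.sum_left _ _ _ fun ν _ => Commute.sum_right _ _ _ fun μ _ =>
    ((h₁ ν μ).mul_right (h₂ ν μ)).mul_left ((h₃ ν μ).mul_right (h₄ ν μ))

/-- The elements `u ν` stand for `X^ν` on the first leg, `e` and `e'` for the places of the second
and third legs. The relations of the pair supply the two identities needed by
`prod_one_sub_add_mul_prod_one_sub`; all other hypotheses hold because distinct places commute. -/
lemma linProd_twist [SMulCommClass K L L] {X : Module.Dual K L →ₗ[K] A}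
    {H : L →ₗ[K] A}
    (hXH : IsSemidirectPair X H) {u : ι → Q} {n k : ℕ} {e : Fin n → A →ₐ[K] Q}
    {e' : Fin k → A →ₐ[K] Q} (huu : ∀ ν μ, Commute (u ν) (u μ))
    (hue : ∀ ν q r, Commute (u ν) (e q r)) (hue' : ∀ ν p r, Commute (u ν) (e' p r))
    (hee : ∀ i j, i ≠ j → ∀ r s, Commute (e i r) (e j s))
    (hee'' : ∀ i j, i ≠ j → ∀ r s, Commute (e' i r) (e' j s))
    (hee' : ∀ i j r s, Commute (e i r) (e' j s)) :
    linProd b H (fun ν => u ν + ∑ q, e q (X (b.coord ν))) e' * linProd b H u e =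
      linProd b H u (Fin.append e e') *
        linProd b H (fun ν => ∑ q, e q (X (b.coord ν))) e' := by
  have h := prod_one_sub_add_mul_prod_one_sub
    (c := fun q => ∑ ν, u ν * e q (H (b ν)))
    (a := fun p => ∑ ν, u ν * e' p (H (b ν)))
    (b := fun q p => ∑ ν, e q (X (b.coord ν)) * e' p (H (b ν)))
    ?_ ?_ ?_ ?_ ?_ ?_
  · have hs : ∀ p : Fin k, ∑ q, ∑ ν, e q (X (b.coord ν)) * e' p (H (b ν)) =
        ∑ ν, (∑ q, e q (X (b.coord ν))) * e' p (H (b ν)) := fun p => by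
      rw [Finset.sum_comm]
      exact Finset.sum_congr rfl fun ν _ => (Finset.sum_mul _ _ _).symm
    simp only [hs] at h
    rw [linProd_append]
    simp only [linProd, add_mul, Finset.sum_add_distrib]
    exact h
  · intro i j
    by_cases hij : i = j
    · rw [hij]
    · exact commute_sum_mul huu (fun ν μ => hue ν j _) (fun ν μ => (hue μ i _).symm)
        fun ν μ => hee i j hij _ _
  · exact fun p j => commute_sum_mul huu (fun ν μ => hue ν j _) (fun ν μ => (hue' μ p _).symm)
      fun ν μ => (hee' j p _ _).symm
  · exact fun q p j hj => commute_sum_mul (fun ν μ => (hue μ q _).symm)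
      (fun ν μ => hee q j hj.symm _ _) (fun ν μ => (hue' μ p _).symm)
      fun ν μ => (hee' j p _ _).symm
  · exact fun p q p' hp => commute_sum_mul (fun ν μ => hue ν q _)
      (fun ν μ => hue' ν p' _) (fun ν μ => (hee' q p _ _).symm)
      fun ν μ => hee'' p p' hp _ _
  · intro q p
    rw [Finset.sum_mul_sum]
    refine Finset.sum_eq_zero fun ν _ => Finset.sum_eq_zero fun μ _ => ?_
    rw [mul_assoc, ← mul_assoc (e q _), ← map_mul, hXH.H_mul_X, map_zero, zero_mul, mul_zero]
  -- This is `b_{qp} c_q = a_p b_{qp}`. For fixed `μ`, the product `X^ν H_μ` in the place `q` is the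
  -- transpose of left multiplication by `H_μ` applied to `X^ν`; it is traded for left
  -- multiplication by `H_μ` in the place `p`.
  · intro q p
    rw [Finset.sum_mul_sum, Finset.sum_comm, Finset.sum_mul_sum]
    refine Finset.sum_congr rfl fun μ _ => ?_
    have hl : ∀ ν, e q (X (b.coord ν)) * e' p (H (b ν)) *
        (u μ * e q (H (b μ))) =
        u μ * (e q (X (b.coord ν ∘ₗ LinearMap.mulLeft K (b μ))) *
          e' p (H (b ν))) := fun ν => by
      rw [← hXH.X_mul_H, map_mul, ← mul_assoc,
        (((hue μ q _).mul_right (hue' μ p _))).symm.eq, mul_assoc, mul_assoc, mul_assoc,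
        (hee' q p _ _).eq]
    have hr : ∀ ν, u μ * e' p (H (b μ)) *
        (e q (X (b.coord ν)) * e' p (H (b ν))) =
        u μ * (e q (X (b.coord ν)) *
          e' p (H (LinearMap.mulLeft K (b μ) (b ν)))) := fun ν => by
      rw [LinearMap.mulLeft_apply, ← hXH.H_mul_H, map_mul, mul_assoc, ← mul_assoc (e' p _),
        (hee' q p _ _).symm.eq, mul_assoc]
    simp only [hl, hr, ← Finset.mul_sum]
    congr 1
    exact sum_coord_comp_mul b ((e q).toLinearMap ∘ₗ X) ((e' p).toLinearMap ∘ₗ H)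
      (LinearMap.mulLeft K (b μ))

end LinProd

/-- The twisting cocycle with the components `∏ⱼ (1 - ∑ᵢ ∑_ν X^ν_i ⊗ H_{ν,j})`. -/
def cocycle (X : Module.Dual K L →ₗ[K] A) (H : L →ₗ[K] A) : TensorBialgebraSq K A := fun m n =>
  linProd b H (fun ν => sumX b X m ν ⊗ₜ[K] (1 : ⨂[K]^n A))
    fun j => Algebra.TensorProduct.includeRight.comp (place K j)

/-- The place `q` of the middle factor of `A^{⊗m} ⊗ A^{⊗n} ⊗ A^{⊗k}`. -/
def placeMiddle (K A : Type*) [Field K] [Ring A] [Algebra K A] (m n k : ℕ) (q : Fin n) : A →ₐ[K]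
    ((⨂[K]^m A) ⊗[K] (⨂[K]^n A)) ⊗[K] (⨂[K]^k A) :=
  Algebra.TensorProduct.includeLeft.comp (Algebra.TensorProduct.includeRight.comp (place K q))

/-- The place `p` of the last factor of `A^{⊗m} ⊗ A^{⊗n} ⊗ A^{⊗k}`. -/
def placeLast (K A : Type*) [Field K] [Ring A] [Algebra K A] (m n k : ℕ) (p : Fin k) : A →ₐ[K]
    ((⨂[K]^m A) ⊗[K] (⨂[K]^n A)) ⊗[K] (⨂[K]^k A) :=
  Algebra.TensorProduct.includeRight.comp (place K p)

lemma placeMiddle_apply (m n k : ℕ) (q : Fin n) (r : A) :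
    placeMiddle K A m n k q r = (1 ⊗ₜ[K] place K q r) ⊗ₜ[K] 1 := rfl

lemma placeLast_apply (m n k : ℕ) (p : Fin k) (r : A) :
    placeLast K A m n k p r = 1 ⊗ₜ[K] place K p r := rfl

lemma sum_placeMiddle {κ : Type*} (b : Module.Basis κ K L) (X : Module.Dual K L →ₗ[K] A)
    (m n k : ℕ) (ν : κ) :
    ∑ q, placeMiddle K A m n k q (X (b.coord ν)) = (1 ⊗ₜ[K] sumX b X n ν) ⊗ₜ[K] 1 := by
  simp only [placeMiddle_apply]
  rw [← TensorProduct.sum_tmul, ← TensorProduct.tmul_sum]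
  rfl

/-- The sum over the places of the first factor of `A^{⊗m} ⊗ A^{⊗n} ⊗ A^{⊗k}` of the dual
basis. -/
def sumXFirst (X : Module.Dual K L →ₗ[K] A) (m n k : ℕ) (ν : ι) :
    ((⨂[K]^m A) ⊗[K] (⨂[K]^n A)) ⊗[K] (⨂[K]^k A) :=
  (sumX b X m ν ⊗ₜ[K] 1) ⊗ₜ[K] 1

/-- The first leg enters only through sums over places, which are primitive, so `Δ` replaces `X^ν`
by its sum over the first two legs. -/
lemma deconcatLeft_cocycle (X : Module.Dual K L →ₗ[K] A) (H : L →ₗ[K] A) (m n k : ℕ) :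
    deconcatLeft K A m n k (cocycle b X H (m + n) k) =
      linProd b H (fun ν => sumXFirst b X m n k ν + ∑ q, placeMiddle K A m n k q (X (b.coord ν)))
        (placeLast K A m n k) := by
  refine (map_linProd (Q := (⨂[K]^(m + n) A) ⊗[K] (⨂[K]^k A))
    (Q' := ((⨂[K]^m A) ⊗[K] (⨂[K]^n A)) ⊗[K] (⨂[K]^k A)) b H
    (deconcatLeft K A m n k).toAlgHom _ _).trans ?_
  congr 1
  · funext ν
    rw [sum_placeMiddle, sumXFirst, ← TensorProduct.add_tmul, ← deconcatEquiv_sumX]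
    rfl
  · funext p
    refine AlgHom.ext fun r => ?_
    exact congrArg (· ⊗ₜ[K] _) (map_one (deconcatEquiv K A m n))

lemma includeLeft_cocycle (X : Module.Dual K L →ₗ[K] A) (H : L →ₗ[K] A) (m n k : ℕ) :
    (Algebra.TensorProduct.includeLeft : _ →ₐ[K] _ ⊗[K] (⨂[K]^k A)) (cocycle b X H m n) =
      linProd b H (sumXFirst b X m n k) (placeMiddle K A m n k) :=
  map_linProd (Q := (⨂[K]^m A) ⊗[K] (⨂[K]^n A))
    (Q' := ((⨂[K]^m A) ⊗[K] (⨂[K]^n A)) ⊗[K] (⨂[K]^k A)) b H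
    (Algebra.TensorProduct.includeLeft : _ →ₐ[K] _ ⊗[K] (⨂[K]^k A)) _ _

/-- The second leg enters as a product over its places, which `Δ` cuts into the places of the second
and of the third leg. -/
lemma deconcatRight_cocycle (X : Module.Dual K L →ₗ[K] A) (H : L →ₗ[K] A) (m n k : ℕ) :
    deconcatRight K A m n k (cocycle b X H m (n + k)) =
      linProd b H (sumXFirst b X m n k)
        (Fin.append (placeMiddle K A m n k) (placeLast K A m n k)) := by
  refine (map_linProd (Q := (⨂[K]^m A) ⊗[K] (⨂[K]^(n + k) A))
    (Q' := ((⨂[K]^m A) ⊗[K] (⨂[K]^n A)) ⊗[K] (⨂[K]^k A)) b H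
    (deconcatRight K A m n k).toAlgHom _ _).trans ?_
  congr 1
  · funext ν
    exact congrArg (fun x => (Algebra.TensorProduct.assoc K K K _ _ _).symm (sumX b X m ν ⊗ₜ[K] x))
      (map_one (deconcatEquiv K A n k))
  · funext j
    refine AlgHom.ext fun r => ?_
    refine Fin.addCases (fun j => ?_) (fun j => ?_) j
    · rw [Fin.append_left]
      exact congrArg (fun x => (Algebra.TensorProduct.assoc K K K _ _ _).symm (1 ⊗ₜ[K] x))
        (deconcatEquiv_place_castAdd j r)
    · rw [Fin.append_right]
      exact congrArg (fun x => (Algebra.TensorProduct.assoc K K K _ _ _).symm (1 ⊗ₜ[K] x))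
        (deconcatEquiv_place_natAdd j r)

lemma includeTwoThree_cocycle (X : Module.Dual K L →ₗ[K] A) (H : L →ₗ[K] A) (m n k : ℕ) :
    includeTwoThree K A m n k (cocycle b X H n k) =
      linProd b H (fun ν => ∑ q, placeMiddle K A m n k q (X (b.coord ν)))
        (placeLast K A m n k) := by
  refine (map_linProd (Q := (⨂[K]^n A) ⊗[K] (⨂[K]^k A))
    (Q' := ((⨂[K]^m A) ⊗[K] (⨂[K]^n A)) ⊗[K] (⨂[K]^k A)) b H
    (includeTwoThree K A m n k) _ _).trans ?_
  congr 1
  funext ν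
  rw [sum_placeMiddle]
  rfl

lemma cocycle_twist [SMulCommClass K L L] {X : Module.Dual K L →ₗ[K] A}
    {H : L →ₗ[K] A}
    (hXH : IsSemidirectPair X H) (m n k : ℕ) :
    deconcatLeft K A m n k (cocycle b X H (m + n) k) *
        (Algebra.TensorProduct.includeLeft : _ →ₐ[K] _ ⊗[K] (⨂[K]^k A)) (cocycle b X H m n) =
      deconcatRight K A m n k (cocycle b X H m (n + k)) *
        includeTwoThree K A m n k (cocycle b X H n k) := by
  rw [deconcatLeft_cocycle, includeLeft_cocycle, deconcatRight_cocycle, includeTwoThree_cocycle]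
  refine linProd_twist b hXH ?_ ?_ ?_ ?_ ?_ ?_
  · intro ν μ
    simp only [Commute, SemiconjBy, sumXFirst, Algebra.TensorProduct.tmul_mul_tmul, mul_one,
      (commute_sumX b hXH m ν μ).eq]
  · intro ν q r
    simp only [Commute, SemiconjBy, sumXFirst, placeMiddle_apply,
      Algebra.TensorProduct.tmul_mul_tmul, mul_one, one_mul]
  · intro ν q r
    simp only [Commute, SemiconjBy, sumXFirst, placeLast_apply,
      Algebra.TensorProduct.tmul_mul_tmul, mul_one, one_mul]
  · intro i j hij r s
    simp only [Commute, SemiconjBy, placeMiddle_apply, Algebra.TensorProduct.tmul_mul_tmul, mul_one,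
      (commute_place hij r s).eq]
  · intro i j hij r s
    simp only [Commute, SemiconjBy, placeLast_apply, Algebra.TensorProduct.tmul_mul_tmul, mul_one,
      (commute_place hij r s).eq]
  · intro i j r s
    simp only [Commute, SemiconjBy, placeMiddle_apply, placeLast_apply,
      Algebra.TensorProduct.tmul_mul_tmul, mul_one, one_mul]

lemma cocycle_zero_left (X : Module.Dual K L →ₗ[K] A) (H : L →ₗ[K] A) (n : ℕ) :
    cocycle b X H 0 n = 1 := by
  simp [cocycle, linProd, sumX]

lemma cocycle_zero_right (X : Module.Dual K L →ₗ[K] A) (H : L →ₗ[K] A) (m : ℕ) :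
    cocycle b X H m 0 = 1 := by
  simp [cocycle, linProd]

/-- With only one place in the first leg, `X X' = 0` makes each factor `1` minus an element of
square zero. -/
lemma isUnit_cocycle_one_left [SMulCommClass K L L] {X : Module.Dual K L →ₗ[K] A}
    {H : L →ₗ[K] A}
    (hXH : IsSemidirectPair X H) (k : ℕ) : IsUnit (cocycle b X H 1 k) := by
  rw [cocycle, linProd]
  refine List.prod_isUnit fun x hx => ?_
  obtain ⟨j, rfl⟩ := List.mem_ofFn.1 hx
  refine IsNilpotent.isUnit_one_sub ⟨2, ?_⟩
  rw [sq, Finset.sum_mul_sum]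
  refine Finset.sum_eq_zero fun ν _ => Finset.sum_eq_zero fun μ _ => ?_
  rw [AlgHom.comp_apply, AlgHom.comp_apply, Algebra.TensorProduct.includeRight_apply,
    Algebra.TensorProduct.includeRight_apply, Algebra.TensorProduct.tmul_mul_tmul,
    Algebra.TensorProduct.tmul_mul_tmul, Algebra.TensorProduct.tmul_mul_tmul, mul_one, mul_one,
    sumX, sumX, Fin.sum_univ_one, Fin.sum_univ_one, ← map_mul (place K 0), hXH.X_mul_X, map_zero,
    TensorProduct.zero_tmul]

end Cocycle

/-! ### The relations of `R` -/

section RingR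

variable (K L : Type*) [Field K] [NonUnitalRing L] [Module K L]
  [SMulCommClass K L L]

/-- `L → R`. -/
def ringH : L →ₗ[K] RingR K L :=
  Unitization.inrHom K K (SemidirectRing K L) ∘ₗ SemidirectRing.ofH K L

/-- `L* → R`. -/
def ringX : Module.Dual K L →ₗ[K] RingR K L :=
  Unitization.inrHom K K (SemidirectRing K L) ∘ₗ SemidirectRing.ofX K L

variable {K L}

lemma ringH_mul_ringH (h h' : L) : ringH K L h * ringH K L h' = ringH K L (h * h') := by
  simp only [ringH, LinearMap.comp_apply, Unitization.inrHom_apply, ← Unitization.inr_mul]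
  rfl

lemma ringX_mul_ringH (ξ : Module.Dual K L) (h : L) :
    ringX K L ξ * ringH K L h = ringX K L (ξ ∘ₗ LinearMap.mulLeft K h) := by
  simp only [ringH, ringX, LinearMap.comp_apply, Unitization.inrHom_apply, ← Unitization.inr_mul]
  congr 1
  exact SemidirectRing.ext' (zero_mul h) fun l => rfl

lemma ringH_mul_ringX (h : L) (ξ : Module.Dual K L) : ringH K L h * ringX K L ξ = 0 := by
  simp only [ringH, ringX, LinearMap.comp_apply, Unitization.inrHom_apply, ← Unitization.inr_mul]
  rw [← Unitization.inr_zero K]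
  congr 1
  exact SemidirectRing.ext' (mul_zero h) fun l => rfl

lemma ringX_mul_ringX (ξ ξ' : Module.Dual K L) : ringX K L ξ * ringX K L ξ' = 0 := by
  simp only [ringX, LinearMap.comp_apply, Unitization.inrHom_apply, ← Unitization.inr_mul]
  rw [← Unitization.inr_zero K]
  congr 1
  exact SemidirectRing.ext' (zero_mul (0 : L)) fun l => (congrArg ξ (zero_mul l)).trans (map_zero ξ)

variable [IsScalarTower K L L] {ι : Type*} [Fintype ι] (b : Module.Basis ι K L)

lemma cocycle_one_left (k : ℕ) :
    cocycle b (ringX K L) (ringH K L) 1 k = splitProduct (phiOneOne b) k := by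
  rw [cocycle, linProd, splitProduct]
  congr 2
  funext j
  rw [phiOneOne, map_sub, map_sum, ← Algebra.TensorProduct.one_def, map_one]
  congr 1
  refine Finset.sum_congr rfl fun ν _ => ?_
  rw [Algebra.TensorProduct.map_tmul, AlgHom.comp_apply, Algebra.TensorProduct.includeRight_apply,
    Algebra.TensorProduct.tmul_mul_tmul, mul_one, one_mul, sumX, Fin.sum_univ_one]
  rfl

variable (K L) in
lemma isSemidirectPair_ringX_ringH : IsSemidirectPair (ringX K L) (ringH K L) :=
  ⟨ringH_mul_ringH, ringX_mul_ringH, ringH_mul_ringX, ringX_mul_ringX⟩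

lemma isReshetikhinExpansion_cocycle :
    IsReshetikhinExpansion (phiOneOne b) (cocycle b (ringX K L) (ringH K L)) where
  isTwistingCocycle :=
    { isUnit := isUnit_of_twist (cocycle_zero_left b _ _)
        (isUnit_cocycle_one_left b (isSemidirectPair_ringX_ringH K L))
        (cocycle_twist b (isSemidirectPair_ringX_ringH K L) 1)
      counit_left := cocycle_zero_left b _ _
      counit_right := cocycle_zero_right b _ _
      twist := fun m n k => (twist_iff _ m n k).2
        (cocycle_twist b (isSemidirectPair_ringX_ringH K L) m n k) }
  one_apply := cocycle_one_left b

end RingR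

/-! ### The exponential form -/

section Logarithm

variable {K L : Type*} [Field K] [NonUnitalRing L] [Module K L]
  [IsScalarTower K L L] [SMulCommClass K L L] {ι : Type*} [Fintype ι] (b : Module.Basis ι K L)

/-- The coordinate of index `ν` of the power `l ^ (d + 1)` as a polynomial in the coordinates of
`l ∈ L`. -/
def powerCoord : ℕ → ι → EnvR K L
  | 0, ν => envX K L (b.coord ν)
  | d + 1, ν => ∑ σ, ∑ μ, b.coord ν (b σ * b μ) • (powerCoord d σ * envX K L (b.coord μ))

/-- The coordinate of index `ν` of `- log (1 - l) = ∑ l ^ d / d` as a power series in the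
coordinates of `l ∈ L`. -/
def logSeries (ν : ι) : PowerSeries (EnvR K L) :=
  PowerSeries.mk fun d => Nat.casesOn d 0 fun d => ((d + 1 : ℕ) : K)⁻¹ • powerCoord b d ν

lemma coeff_succ_logSeries (d : ℕ) (ν : ι) :
    PowerSeries.coeff (d + 1) (logSeries b ν) = ((d + 1 : ℕ) : K)⁻¹ • powerCoord b d ν :=
  PowerSeries.coeff_mk _ _

lemma constantCoeff_logSeries (ν : ι) : PowerSeries.constantCoeff (logSeries b ν) = 0 := by
  rw [← PowerSeries.coeff_zero_eq_constantCoeff_apply]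
  exact PowerSeries.coeff_mk _ _

lemma powerCoord_mem_envLDual (d : ℕ) (ν : ι) : powerCoord b d ν ∈ envLDual K L (d + 1) := by
  induction d generalizing ν with
  | zero =>
    rw [envLDual, zero_add, pow_one]
    exact ⟨_, rfl⟩
  | succ d ih =>
    rw [envLDual, pow_succ]
    exact Submodule.sum_mem _ fun σ _ => Submodule.sum_mem _ fun μ _ =>
      Submodule.smul_mem _ _ (Submodule.mul_mem_mul (ih σ) ⟨_, rfl⟩)

lemma isSeriesInX_logSeries (ν : ι) : IsSeriesInX (logSeries b ν) := by
  intro d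
  cases d with
  | zero =>
    rw [PowerSeries.coeff_zero_eq_constantCoeff_apply, constantCoeff_logSeries]
    exact Submodule.zero_mem _
  | succ d =>
    rw [coeff_succ_logSeries]
    exact Submodule.smul_mem _ _ (powerCoord_mem_envLDual b d ν)

/-- The element `∑ X^ν ⊗ H_ν` is a generic element of `L`, with the `X^ν` as coordinates. Since `g`
is multiplicative, its powers are computed with the structure constants of `L`, which is the
recursion of `powerCoord`. -/
lemma sum_powerCoord_tmul {A₁ A₂ : Type*} [Ring A₁] [Algebra K A₁] [Ring A₂] [Algebra K A₂]
    (ψ : EnvR K L →ₐ[K] A₁) (g : L →ₗ[K] A₂) (hg : ∀ h h', g h * g h' = g (h * h')) (d : ℕ) :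
    ∑ ν, ψ (powerCoord b d ν) ⊗ₜ[K] g (b ν) =
      (∑ ν, ψ (envX K L (b.coord ν)) ⊗ₜ[K] g (b ν)) ^ (d + 1) := by
  induction d with
  | zero => rw [zero_add, pow_one]; rfl
  | succ d ih =>
    rw [pow_succ, ← ih, Finset.sum_mul_sum]
    have h₁ : ∀ ν, ψ (powerCoord b (d + 1) ν) ⊗ₜ[K] g (b ν) =
        ∑ σ, ∑ μ, (ψ (powerCoord b d σ) * ψ (envX K L (b.coord μ))) ⊗ₜ[K]
          (b.coord ν (b σ * b μ) • g (b ν)) := fun ν => by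
      simp only [powerCoord, map_sum, TensorProduct.sum_tmul, map_smul, map_mul,
        TensorProduct.tmul_smul, TensorProduct.smul_tmul']
    rw [Finset.sum_congr rfl fun ν _ => h₁ ν, Finset.sum_comm]
    refine Finset.sum_congr rfl fun σ _ => ?_
    rw [Finset.sum_comm]
    refine Finset.sum_congr rfl fun μ _ => ?_
    rw [← TensorProduct.tmul_sum, Algebra.TensorProduct.tmul_mul_tmul, hg]
    congr 1
    simp only [← map_smul, ← map_sum]
    exact congrArg g (b.sum_repr (b σ * b μ))

/-! ### The completion of `U(L*) ⊗ U(L)` -/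

lemma mul_mem_range_mapIncl {d e : ℕ} {x y : EnvR K L ⊗[K] EnvR K L}
    (hx : x ∈ LinearMap.range (TensorProduct.mapIncl (envLDual K L d) (envL K L).toSubmodule))
    (hy : y ∈ LinearMap.range (TensorProduct.mapIncl (envLDual K L e) (envL K L).toSubmodule)) :
    x * y ∈
      LinearMap.range (TensorProduct.mapIncl (envLDual K L (d + e)) (envL K L).toSubmodule) := by
  obtain ⟨x, rfl⟩ := hx
  obtain ⟨y, rfl⟩ := hy
  induction x using TensorProduct.induction_on with
  | zero => rw [map_zero, zero_mul]; exact Submodule.zero_mem _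
  | add x₁ x₂ h₁ h₂ => rw [map_add, add_mul]; exact Submodule.add_mem _ h₁ h₂
  | tmul a u =>
    induction y using TensorProduct.induction_on with
    | zero => rw [map_zero, mul_zero]; exact Submodule.zero_mem _
    | add y₁ y₂ h₁ h₂ => rw [map_add, mul_add]; exact Submodule.add_mem _ h₁ h₂
    | tmul a' u' =>
      have ha : (a : EnvR K L) * a' ∈ envLDual K L (d + e) := by
        rw [envLDual, pow_add]
        exact Submodule.mul_mem_mul a.2 a'.2
      exact ⟨⟨_, ha⟩ ⊗ₜ[K] ⟨_, (envL K L).mul_mem u.2 u'.2⟩,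
        (Algebra.TensorProduct.tmul_mul_tmul _ _ _ _).symm⟩

lemma MemCompletedTensor.pow {F : PowerSeries (EnvR K L ⊗[K] EnvR K L)}
    (hF : MemCompletedTensor F) (j : ℕ) : MemCompletedTensor (F ^ j) := by
  induction j with
  | zero =>
    intro d
    rw [pow_zero, PowerSeries.coeff_one]
    split_ifs with hd
    · subst hd
      have h1 : (1 : EnvR K L) ∈ envLDual K L 0 := by
        rw [envLDual, pow_zero]
        exact Submodule.one_le.1 le_rfl
      exact ⟨⟨1, h1⟩ ⊗ₜ[K] ⟨1, (envL K L).one_mem⟩, rfl⟩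
    · exact Submodule.zero_mem _
  | succ j ih =>
    intro d
    rw [pow_succ, PowerSeries.coeff_mul]
    refine Submodule.sum_mem _ fun x hx => ?_
    rw [Finset.HasAntidiagonal.mem_antidiagonal] at hx
    rw [← hx]
    exact mul_mem_range_mapIncl (ih _) (hF _)

lemma MemCompletedTensor.seriesExp {F : PowerSeries (EnvR K L ⊗[K] EnvR K L)}
    (hF : MemCompletedTensor F) : MemCompletedTensor (seriesExp K F) := by
  intro d
  rw [_root_.seriesExp, PowerSeries.coeff_mk]
  exact Submodule.sum_mem _ fun j _ => Submodule.smul_mem _ _ (hF.pow j d)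

lemma coeff_neg_sum_seriesTmul (f : ι → PowerSeries (EnvR K L)) (d : ℕ) :
    PowerSeries.coeff d (-∑ ν, seriesTmul (f ν) (envH K L (b ν))) =
      -∑ ν, PowerSeries.coeff d (f ν) ⊗ₜ[K] envH K L (b ν) := by
  rw [map_neg, map_sum]
  simp only [seriesTmul, PowerSeries.coeff_mk]

lemma memCompletedTensor_neg_sum_seriesTmul {f : ι → PowerSeries (EnvR K L)}
    (hf : ∀ ν, IsSeriesInX (f ν)) :
    MemCompletedTensor (-∑ ν, seriesTmul (f ν) (envH K L (b ν))) := by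
  intro d
  rw [coeff_neg_sum_seriesTmul]
  refine Submodule.neg_mem _ (Submodule.sum_mem _ fun ν _ => ?_)
  exact ⟨⟨_, hf ν d⟩ ⊗ₜ[K] ⟨_, Algebra.subset_adjoin ⟨b ν, rfl⟩⟩, rfl⟩

/-! ### The images in the tensor powers -/

attribute [local instance 100] LieRing.ofAssociativeRing

lemma tensorRep_ι (n : ℕ) (x : SemidirectRing K L) :
    tensorRep K L n (UniversalEnvelopingAlgebra.ι K x) =
      ∑ i : Fin n, place K i (x : RingR K L) := by
  rw [tensorRep, UniversalEnvelopingAlgebra.lift_ι_apply]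
  exact LinearMap.sum_apply _ _ _

lemma tensorRep_envX {κ : Type*} (b : Module.Basis κ K L) (m : ℕ) (ν : κ) :
    tensorRep K L m (envX K L (b.coord ν)) = sumX b (ringX K L) m ν :=
  tensorRep_ι m _

lemma tensorRep_envH (n : ℕ) (h : L) :
    tensorRep K L n (envH K L h) = ∑ j : Fin n, place K j (ringH K L h) :=
  tensorRep_ι n _

/-- The sum of the `X^ν ⊗ H_ν` with `H_ν` in the place `j`. -/
def pairing (m n : ℕ) (j : Fin n) : (⨂[K]^m (RingR K L)) ⊗[K] (⨂[K]^n (RingR K L)) :=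
  ∑ ν, sumX b (ringX K L) m ν ⊗ₜ[K] place K j (ringH K L (b ν))

lemma cocycle_eq_prod_pairing (m n : ℕ) :
    cocycle b (ringX K L) (ringH K L) m n = (List.ofFn fun j => 1 - pairing b m n j).prod := by
  rw [cocycle, linProd]
  congr 2
  funext j
  congr 1
  refine Finset.sum_congr rfl fun ν _ => ?_
  rw [AlgHom.comp_apply, Algebra.TensorProduct.includeRight_apply,
    Algebra.TensorProduct.tmul_mul_tmul, mul_one, one_mul]

lemma commute_pairing (m n : ℕ) (i j : Fin n) : Commute (pairing b m n i) (pairing b m n j) := by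
  by_cases hij : i = j
  · rw [hij]
  · have h : ∀ ν μ, Commute
        (sumX b (ringX K L) m ν ⊗ₜ[K] place K i (ringH K L (b ν)))
        (sumX b (ringX K L) m μ ⊗ₜ[K] place K j (ringH K L (b μ))) := fun ν μ => by
      rw [Commute, SemiconjBy, Algebra.TensorProduct.tmul_mul_tmul,
        Algebra.TensorProduct.tmul_mul_tmul,
        (commute_sumX b (isSemidirectPair_ringX_ringH K L) m ν μ).eq, (commute_place hij _ _).eq]
    exact Commute.sum_left _ _ _ fun ν _ => Commute.sum_right _ _ _ fun μ _ => h ν μ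

/-- `H_ν` acts by the sum over the places `j`, and in each single place `ringH` is multiplicative.
So the image is a power sum of the commuting elements `pairing b m n j`. -/
lemma map_tensorRep_sum_powerCoord (m n d : ℕ) :
    Algebra.TensorProduct.map (tensorRep K L m) (tensorRep K L n)
        (∑ ν, powerCoord b d ν ⊗ₜ[K] envH K L (b ν)) = ∑ j, pairing b m n j ^ (d + 1) := by
  rw [map_sum]
  simp only [Algebra.TensorProduct.map_tmul, tensorRep_envH, TensorProduct.tmul_sum]
  rw [Finset.sum_comm]
  refine Finset.sum_congr rfl fun j _ => ?_
  rw [pairing]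
  simp only [← tensorRep_envX]
  exact sum_powerCoord_tmul b (tensorRep K L m) ((place K j).toLinearMap ∘ₗ ringH K L)
    (fun h h' => by
      simp only [LinearMap.comp_apply, AlgHom.toLinearMap_apply, ← map_mul (place K j),
        ringH_mul_ringH]) d

lemma represents_seriesExp_logSeries [CharZero K] :
    Represents (seriesExp K (-∑ ν, seriesTmul (logSeries b ν) (envH K L (b ν))))
      (cocycle b (ringX K L) (ringH K L)) := by
  intro m n
  set θ := Algebra.TensorProduct.map (tensorRep K L m) (tensorRep K L n) with hθ
  have h := eventually_sum_coeff_seriesExp (K := K) (pairing b m n) (commute_pairing b m n)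
    (f := PowerSeries.map θ.toRingHom (-∑ ν, seriesTmul (logSeries b ν) (envH K L (b ν)))) ?_ ?_
  · rw [cocycle_eq_prod_pairing]
    filter_upwards [h] with N hN
    rw [← hN]
    refine Finset.sum_congr rfl fun d _ => ?_
    exact congrArg (PowerSeries.coeff d) (map_seriesExp (A := EnvR K L ⊗[K] EnvR K L)
      (B := (⨂[K]^m (RingR K L)) ⊗[K] (⨂[K]^n (RingR K L))) θ _)
  · rw [← PowerSeries.coeff_zero_eq_constantCoeff_apply, PowerSeries.coeff_map,
      coeff_neg_sum_seriesTmul]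
    simp [constantCoeff_logSeries]
  -- The coefficients of the exponent are mapped to those of `∑_j log (1 - c_j t)` with `c_j =
  -- pairing b m n j`.
  · intro d
    rw [PowerSeries.coeff_map, coeff_neg_sum_seriesTmul]
    simp only [coeff_succ_logSeries, ← TensorProduct.smul_tmul', ← Finset.smul_sum]
    rw [← map_tensorRep_sum_powerCoord, ← map_smul, ← map_neg]
    rfl

end Logarithm

end

theorem theorem2 {K L : Type*} [Field K] [CharZero K] [NonUnitalRing L] [Module K L]
    [IsScalarTower K L L] [SMulCommClass K L L] {ι : Type*} [Fintype ι]
    (b : Module.Basis ι K L) :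
    (∃! Φ : TensorBialgebraSq K (RingR K L), IsReshetikhinExpansion (phiOneOne b) Φ) ∧
    ∀ Φ : TensorBialgebraSq K (RingR K L), IsReshetikhinExpansion (phiOneOne b) Φ →
      ∃ Xt : ι → PowerSeries (EnvR K L),
        (∀ ν, IsSeriesInX (Xt ν) ∧ PowerSeries.constantCoeff (Xt ν) = 0) ∧
        MemCompletedTensor (seriesExp K (-∑ ν, seriesTmul (Xt ν) (envH K L (b ν)))) ∧
        Represents (seriesExp K (-∑ ν, seriesTmul (Xt ν) (envH K L (b ν)))) Φ := by
  refine ⟨⟨_, isReshetikhinExpansion_cocycle b,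
    fun Φ hΦ => hΦ.unique (isReshetikhinExpansion_cocycle b)⟩, fun Φ hΦ => ?_⟩
  rw [hΦ.unique (isReshetikhinExpansion_cocycle b)]
  exact ⟨logSeries b, fun ν => ⟨isSeriesInX_logSeries b ν, constantCoeff_logSeries b ν⟩,
    (memCompletedTensor_neg_sum_seriesTmul b (isSeriesInX_logSeries b)).seriesExp,
    represents_seriesExp_logSeries b⟩
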